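/- Let $H$ be a non-degenerate Hamiltonian on a $d$-dimensional quantum system, that is, a Hermitian operator on $\mathbb C^d$ with $d$ distinct eigenvalues $E_1,\dots,E_d$ and an orthonormal basis of eigenvectors $|1\rangle,\dots,|d\rangle$, $H|i\rangle=E_i|i\rangle$. A state is a positive semidefinite operator of trace one, and a quantum channel is a completely positive, trace-preserving linear map on the operators on $\mathbb C^d$. The ergotropy of a state $\rho$ is $$\mathrm{Erg}(\rho)=\mathrm{Tr}[H\rho]-\min_U \mathrm{Tr}[H\,U\rho U^\dagger],$$ where the minimum is over all unitary operators $U$ on $\mathbb C^d$. A state $\tau$ is passive if $\mathrm{Erg}(\tau)=0$. A channel $\mathcal E$ is energy-preserving if $\langle i|\mathcal E(\rho)|i\rangle=\langle i|\rho|i\rangle$ for every state $\rho$ and every $i\in\{1,\dots,d\}$. Let $\mathcal C$ be a quantum channel such that $\mathcal C(\rho)=p\,\mathcal E(\rho)+(1-p)\,\tau$ for every state $\rho$, where $p\in[0,1]$, $\tau$ is a passive state, and $\mathcal E$ is a quantum channel. Suppose that either 1. $\mathcal E$ is energy-preserving, or 2. $\mathcal E$ is unital ($\mathcal E(I)=I$)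 and does not increase the average energy, i.e. $\mathrm{Tr}[H\,\mathcal E(\rho)]\le\mathrm{Tr}[H\rho]$ for every state $\rho$. Then $\mathcal C$ is ergotropy non-increasing: $\mathrm{Erg}(\mathcal C(\rho))\le\mathrm{Erg}(\rho)$ for every state $\rho$. -/

import Mathlib

open scoped MatrixOrder Matrix.Norms.L2Operator ComplexOrder

/-- Operators on a `d`-dimensional quantum system, as matrices in a fixed orthonormal basis. -/
abbrev Op (d : ℕ) : Type := Matrix (Fin d) (Fin d) ℂ

/-- Quantum states: positive semidefinite operators of unit trace. -/
structure IsState {d : ℕ} (ρ : Op d) : Prop where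
  posSemidef : ρ.PosSemidef
  trace_eq_one : ρ.trace = 1

/-- Quantum channels: completely positive, trace preserving linear maps. -/
structure QuantumChannel (d : ℕ) extends CompletelyPositiveMap (Op d) (Op d) where
  trace_map' : ∀ X : Op d, (toLinearMap X).trace = X.trace

noncomputable instance (d : ℕ) : CoeFun (QuantumChannel d) (fun _ => Op d → Op d) where
  coe Φ := Φ.toLinearMap

/-- `(b i)` is an orthonormal basis of eigenvectors of `H`, with pairwise distinct real
eigenvalues `E i`; so `H` is a non-degenerate Hamiltonian. -/
structure IsNondegenerateEigenbasis {d : ℕ} (H : Op d) (E : Fin d → ℝ)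
    (b : OrthonormalBasis (Fin d) ℂ (EuclideanSpace ℂ (Fin d))) : Prop where
  injective : Function.Injective E
  apply_eq : ∀ i, Matrix.toEuclideanLin H (b i) = (E i : ℂ) • b i

/-- The expectation value `⟨H⟩_σ = Tr[H σ]` (a real number for Hermitian `H` and `σ`). -/
noncomputable def meanEnergy {d : ℕ} (H σ : Op d) : ℝ := (H * σ).trace.re

/-- The mean energy attains its minimum over the unitary orbit of an operator, so the infimum
in the definition of the ergotropy is a minimum. -/
theorem exists_isLeast_meanEnergy {d : ℕ} (H ρ : Op d) :
    ∃ U : Matrix.unitaryGroup (Fin d) ℂ,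
      IsLeast (Set.range fun V : Matrix.unitaryGroup (Fin d) ℂ =>
          meanEnergy H ((V : Op d) * ρ * star (V : Op d)))
        (meanEnergy H ((U : Op d) * ρ * star (U : Op d))) := by
  have hc : IsCompact (Matrix.unitaryGroup (Fin d) ℂ : Set (Op d)) := by
    refine Metric.isCompact_of_isClosed_isBounded ?_ ?_
    · exact isClosed_unitary
    · refine isBounded_iff_forall_norm_le.2 ⟨1, fun U hU => ?_⟩
      rcases isEmpty_or_nonempty (Fin d) with h | h
      · rw [Subsingleton.elim U 0]; simp
      · exact (CStarRing.norm_of_mem_unitary hU).le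
  have hf : Continuous fun V : Op d => meanEnergy H (V * ρ * star V) := by
    unfold meanEnergy
    fun_prop
  obtain ⟨U, hU, hmin⟩ := hc.exists_isMinOn ⟨1, one_mem _⟩ hf.continuousOn
  refine ⟨⟨U, hU⟩, ⟨⟨U, hU⟩, rfl⟩, ?_⟩
  rintro _ ⟨V, rfl⟩
  exact hmin V.2

/-- The ergotropy `Erg(ρ) = ⟨H⟩_ρ - min_U ⟨H⟩_{U ρ U†}`, the minimum being over all unitaries. -/
noncomputable def ergotropy {d : ℕ} (H ρ : Op d) : ℝ :=
  meanEnergy H ρ -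
    ⨅ U : Matrix.unitaryGroup (Fin d) ℂ, meanEnergy H ((U : Op d) * ρ * star (U : Op d))

/-- Passive states: states of zero ergotropy. -/
structure IsPassive {d : ℕ} (H τ : Op d) : Prop where
  isState : IsState τ
  ergotropy_eq_zero : ergotropy H τ = 0

/-- Energy-preserving channels: `⟨i|Φ(ρ)|i⟩ = ⟨i|ρ|i⟩` for every state `ρ` and every vector `|i⟩`
of the energy eigenbasis. -/
def IsEnergyPreserving {d : ℕ} (b : OrthonormalBasis (Fin d) ℂ (EuclideanSpace ℂ (Fin d)))
    (Φ : QuantumChannel d) : Prop :=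
  ∀ ρ : Op d, IsState ρ → ∀ i,
    inner ℂ (b i) (Matrix.toEuclideanLin (Φ ρ) (b i)) =
      inner ℂ (b i) (Matrix.toEuclideanLin ρ (b i))

/-- Unital channels that do not increase the average energy of any state. -/
structure IsUnitalEnergyNonincreasing {d : ℕ} (H : Op d) (Φ : QuantumChannel d) : Prop where
  map_one : Φ 1 = 1
  meanEnergy_le : ∀ ρ : Op d, IsState ρ → meanEnergy H (Φ ρ) ≤ meanEnergy H ρ

/-- `C` is a random mixture of the channel `Φ` and a passive reset:
`C(ρ) = p Φ(ρ) + (1 - p) τ` for all states `ρ`, with `p` a probability and `τ` passive. -/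
def IsPassiveResetMixture {d : ℕ} (H : Op d) (Φ C : QuantumChannel d) : Prop :=
  ∃ (p : ℝ) (τ : Op d), 0 ≤ p ∧ p ≤ 1 ∧ IsPassive H τ ∧
    ∀ ρ : Op d, IsState ρ → C ρ = (p : ℂ) • Φ ρ + ((1 - p : ℝ) : ℂ) • τ

/-- Mixtures of an energy-preserving channel and a passive reset (EPCPR channels). -/
def IsEPCPR {d : ℕ} (H : Op d) (b : OrthonormalBasis (Fin d) ℂ (EuclideanSpace ℂ (Fin d)))
    (C : QuantumChannel d) : Prop :=
  ∃ Φ : QuantumChannel d, IsEnergyPreserving b Φ ∧ IsPassiveResetMixture H Φ C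

/-- Mixtures of a unital, average energy non-increasing channel and a passive reset (UAENICPR
channels). -/
def IsUAENICPR {d : ℕ} (H : Op d) (C : QuantumChannel d) : Prop :=
  ∃ Φ : QuantumChannel d, IsUnitalEnergyNonincreasing H Φ ∧ IsPassiveResetMixture H Φ C

/-- Ergotropy non-increasing channels. -/
def IsErgotropyNonincreasing {d : ℕ} (H : Op d) (C : QuantumChannel d) : Prop :=
  ∀ ρ : Op d, IsState ρ → ergotropy H (C ρ) ≤ ergotropy H ρ

/-! Ergotropy is convex: mean energy is linear, and its minimum over the unitary orbit is concave.
Since it is nonnegative and vanishes at the passive state, `Erg(C ρ) ≤ p Erg(Φ ρ) ≤ Erg(Φ ρ)`, so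
only `Φ` matters.

For unital `Φ`, the crux is that the least orbit energy does not drop
(`QuantumChannel.iInf_meanEnergy_le_map`). Between eigenbases of `ρ` and of a rotated `H`, `Φ` acts
as a doubly stochastic matrix. By Birkhoff's theorem the output energy averages sums `∑ E i * r (σ
i)`, each attained on the orbit of `ρ`.

Energy-preserving channels reduce to this case: positivity forces them to fix the energy
eigenprojectors, hence the identity, and mean energy depends only on the populations. -/

/-- Completely positive maps between matrix algebras preserve positive semidefiniteness. -/
theorem QuantumChannel.posSemidef_map {d : ℕ} (Φ : QuantumChannel d) {X : Op d}
    (hX : X.PosSemidef) : (Φ X).PosSemidef := by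
  have h : 0 ≤ Φ.toCompletelyPositiveMap X := map_nonneg Φ.toCompletelyPositiveMap hX.nonneg
  exact Matrix.nonneg_iff_posSemidef.1 h

/-! ### Convexity of the ergotropy -/

theorem meanEnergy_add {d : ℕ} (H X Y : Op d) :
    meanEnergy H (X + Y) = meanEnergy H X + meanEnergy H Y := by
  simp [meanEnergy, mul_add]

theorem meanEnergy_smul {d : ℕ} (H X : Op d) (p : ℝ) :
    meanEnergy H ((p : ℂ) • X) = p * meanEnergy H X := by
  simp [meanEnergy]

/-- The least mean energy over the unitary orbit is a lower bound for the orbit. -/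
theorem iInf_meanEnergy_le {d : ℕ} (H ρ : Op d) (U : Matrix.unitaryGroup (Fin d) ℂ) :
    ⨅ V : Matrix.unitaryGroup (Fin d) ℂ, meanEnergy H ((V : Op d) * ρ * star (V : Op d)) ≤
      meanEnergy H ((U : Op d) * ρ * star (U : Op d)) := by
  obtain ⟨W, hW⟩ := exists_isLeast_meanEnergy H ρ
  -- Attainment of the minimum supplies the lower bound that the real infimum needs.
  exact ciInf_le ⟨_, hW.2⟩ U

theorem ergotropy_nonneg {d : ℕ} (H ρ : Op d) : 0 ≤ ergotropy H ρ := by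
  have h := iInf_meanEnergy_le H ρ 1
  simp only [OneMemClass.coe_one, one_mul, star_one, mul_one] at h
  exact sub_nonneg.2 h

/-- The ergotropy is a convex function of the state. -/
theorem ergotropy_mix_le {d : ℕ} (H X Y : Op d) {p : ℝ} (hp0 : 0 ≤ p) (hp1 : p ≤ 1) :
    ergotropy H ((p : ℂ) • X + ((1 - p : ℝ) : ℂ) • Y) ≤
      p * ergotropy H X + (1 - p) * ergotropy H Y := by
  have key : p * (⨅ V : Matrix.unitaryGroup (Fin d) ℂ,
        meanEnergy H ((V : Op d) * X * star (V : Op d))) +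
      (1 - p) * (⨅ V : Matrix.unitaryGroup (Fin d) ℂ,
        meanEnergy H ((V : Op d) * Y * star (V : Op d))) ≤
      ⨅ V : Matrix.unitaryGroup (Fin d) ℂ,
        meanEnergy H ((V : Op d) * ((p : ℂ) • X + ((1 - p : ℝ) : ℂ) • Y) * star (V : Op d)) := by
    refine le_ciInf fun V => ?_
    rw [mul_add, add_mul, meanEnergy_add, mul_smul_comm, smul_mul_assoc, mul_smul_comm,
      smul_mul_assoc, meanEnergy_smul, meanEnergy_smul]
    exact add_le_add (mul_le_mul_of_nonneg_left (iInf_meanEnergy_le H X V) hp0)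
      (mul_le_mul_of_nonneg_left (iInf_meanEnergy_le H Y V) (sub_nonneg.2 hp1))
  simp only [ergotropy, meanEnergy_add, meanEnergy_smul] at key ⊢
  linarith

/-! ### Unital channels and Birkhoff's theorem -/

/-- The mean energy of an operator in terms of its populations in the energy eigenbasis. -/
theorem meanEnergy_conj_diagonal {d : ℕ} (B X : Op d) (E : Fin d → ℝ) :
    meanEnergy (B * Matrix.diagonal (fun i => (E i : ℂ)) * star B) X =
      ∑ i, E i * ((star B * X * B) i i).re := by
  rw [meanEnergy, Matrix.mul_assoc, Matrix.mul_assoc, Matrix.trace_mul_comm, Matrix.mul_assoc,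
    Matrix.trace]
  simp only [Matrix.diag_apply, Matrix.diagonal_mul, Complex.re_sum, Complex.re_ofReal_mul]

/-- The transition matrix of a unital channel between two orthonormal bases, given by the columns
of the unitaries `F` and `G`, is doubly stochastic. -/
theorem QuantumChannel.transition_mem_doublyStochastic {d : ℕ} (Φ : QuantumChannel d)
    (h1 : Φ 1 = 1) (F G : Matrix.unitaryGroup (Fin d) ℂ) :
    (Matrix.of fun i j => ((star (G : Op d) *
        Φ ((F : Op d) * Matrix.single j j 1 * star (F : Op d)) * (G : Op d)) i i).re) ∈
      doublyStochastic ℝ (Fin d) := by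
  rw [mem_doublyStochastic_iff_sum]
  -- Entries are nonnegative by positivity, row sums are 1 by unitality, column sums by trace
  -- preservation.
  refine ⟨fun i j => ?_, fun i => ?_, fun j => ?_⟩
  · have hs : (Matrix.single j j (1 : ℂ)).PosSemidef := by
      rw [← Matrix.diagonal_single]
      exact Matrix.PosSemidef.diagonal (Pi.single_nonneg.2 zero_le_one)
    have h := (Φ.posSemidef_map (hs.mul_mul_conjTranspose_same (F : Op d))).conjTranspose_mul_mul_same
      (G : Op d)
    exact (Complex.nonneg_iff.1 (h.diag_nonneg (i := i))).1
  · have hsum : ∑ j, (F : Op d) * Matrix.single j j 1 * star (F : Op d) = 1 := by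
      rw [← Finset.sum_mul, ← Finset.mul_sum, Matrix.sum_single_one, mul_one,
        Unitary.mul_star_self_of_mem F.2]
    have h := congrArg (fun X => ((star (G : Op d) * X * (G : Op d)) i i).re)
      ((map_sum Φ.toLinearMap _ _).symm.trans ((congrArg Φ hsum).trans h1))
    simpa [Finset.mul_sum, Finset.sum_mul, Matrix.sum_apply] using h
  · have h : (star (G : Op d) *
        Φ ((F : Op d) * Matrix.single j j 1 * star (F : Op d)) * (G : Op d)).trace = 1 := by
      rw [Matrix.trace_mul_comm, ← mul_assoc, Unitary.mul_star_self_of_mem G.2, one_mul, Φ.trace_map',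
        Matrix.trace_mul_comm, ← mul_assoc, Unitary.coe_star_mul_self, one_mul,
        Matrix.trace_single_eq_same]
    simpa [Matrix.trace] using congrArg Complex.re h

/-- Permuting the eigenvalues of `ρ` over the energy levels does not go below the least mean
energy over the unitary orbit. -/
theorem iInf_meanEnergy_le_sum_perm {d : ℕ} (B F : Matrix.unitaryGroup (Fin d) ℂ)
    (E r : Fin d → ℝ) (σ : Equiv.Perm (Fin d)) :
    ⨅ V : Matrix.unitaryGroup (Fin d) ℂ,
        meanEnergy ((B : Op d) * Matrix.diagonal (fun i => (E i : ℂ)) * star (B : Op d))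
          ((V : Op d) * ((F : Op d) * Matrix.diagonal (fun i => (r i : ℂ)) * star (F : Op d)) *
            star (V : Op d)) ≤
      ∑ i, E i * r (σ i) := by
  have hP : σ.permMatrix ℂ ∈ Matrix.unitaryGroup (Fin d) ℂ := by
    rw [Matrix.mem_unitaryGroup_iff, Matrix.star_eq_conjTranspose, Matrix.conjTranspose_permMatrix,
      ← Matrix.permMatrix_mul, inv_mul_cancel, Matrix.permMatrix_one]
  -- This unitary carries the eigenbasis of `ρ` to that of `H`, permuted by `σ`.
  refine (iInf_meanEnergy_le _ _ (B * ⟨_, hP⟩ * star F)).trans_eq ?_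
  rw [meanEnergy_conj_diagonal]
  refine Finset.sum_congr rfl fun i _ => ?_
  have hB := Unitary.coe_star_mul_self B
  have hF := Unitary.coe_star_mul_self F
  have : star (B : Op d) * (((B * ⟨_, hP⟩ * star F : Matrix.unitaryGroup (Fin d) ℂ) : Op d) *
      ((F : Op d) * Matrix.diagonal (fun i => (r i : ℂ)) * star (F : Op d)) *
      star ((B * ⟨_, hP⟩ * star F : Matrix.unitaryGroup (Fin d) ℂ) : Op d)) * (B : Op d) =
      σ.permMatrix ℂ * Matrix.diagonal (fun i => (r i : ℂ)) * star (σ.permMatrix ℂ) := by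
    simp only [Submonoid.coe_mul, Unitary.coe_star, star_mul, star_star]
    calc _ = (star (B : Op d) * B) * σ.permMatrix ℂ * (star (F : Op d) * F) *
          Matrix.diagonal (fun i => (r i : ℂ)) * (star (F : Op d) * F) * star (σ.permMatrix ℂ) *
          (star (B : Op d) * B) := by simp only [mul_assoc]
      _ = _ := by rw [hB, hF]; simp only [one_mul, mul_one]
  rw [this, Matrix.star_eq_conjTranspose, Matrix.conjTranspose_permMatrix]
  have hσ : (Equiv.symm σ⁻¹) i = σ i := rfl
  simp [Equiv.Perm.permMatrix, PEquiv.toMatrix_toPEquiv_mul, PEquiv.mul_toMatrix_toPEquiv, hσ]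

/-- A unital channel does not lower the least mean energy over the unitary orbit. -/
theorem QuantumChannel.iInf_meanEnergy_le_map {d : ℕ} (Φ : QuantumChannel d) (h1 : Φ 1 = 1)
    {H ρ : Op d} (hH : H.IsHermitian) (hρ : ρ.IsHermitian) :
    ⨅ V : Matrix.unitaryGroup (Fin d) ℂ, meanEnergy H ((V : Op d) * ρ * star (V : Op d)) ≤
      ⨅ V : Matrix.unitaryGroup (Fin d) ℂ, meanEnergy H ((V : Op d) * Φ ρ * star (V : Op d)) := by
  refine le_ciInf fun U => ?_
  obtain ⟨B, E, hB⟩ : ∃ (B : Matrix.unitaryGroup (Fin d) ℂ) (E : Fin d → ℝ),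
      H = (B : Op d) * Matrix.diagonal (fun i => (E i : ℂ)) * star (B : Op d) :=
    ⟨hH.eigenvectorUnitary, hH.eigenvalues, hH.spectral_theorem⟩
  obtain ⟨F, r, hF⟩ : ∃ (F : Matrix.unitaryGroup (Fin d) ℂ) (r : Fin d → ℝ),
      ρ = (F : Op d) * Matrix.diagonal (fun i => (r i : ℂ)) * star (F : Op d) :=
    ⟨hρ.eigenvectorUnitary, hρ.eigenvalues, hρ.spectral_theorem⟩
  -- The conjugation by `U` is moved onto `H`: `star U * B` diagonalizes `star U * H * U`.
  obtain ⟨w, hw0, hw1, hw⟩ := exists_eq_sum_perm_of_mem_doublyStochastic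
    (Φ.transition_mem_doublyStochastic h1 F (star U * B))
  have hr : ρ = ∑ j, (r j : ℂ) • ((F : Op d) * Matrix.single j j 1 * star (F : Op d)) := by
    have hj : ∀ j, (r j : ℂ) • ((F : Op d) * Matrix.single j j 1 * star (F : Op d)) =
        (F : Op d) * Matrix.single j j (r j : ℂ) * star (F : Op d) := fun j => by
      rw [← smul_mul_assoc, ← mul_smul_comm, Matrix.smul_single, smul_eq_mul, mul_one]
    rw [Finset.sum_congr rfl fun j _ => hj j, ← Finset.sum_mul, ← Finset.mul_sum,
      Matrix.sum_single_eq_diagonal]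
    exact hF
  have hE : meanEnergy H ((U : Op d) * Φ ρ * star (U : Op d)) =
      ∑ i, ∑ j, E i * r j * ((star ((star U * B : Matrix.unitaryGroup (Fin d) ℂ) : Op d) *
        Φ ((F : Op d) * Matrix.single j j 1 * star (F : Op d)) *
        ((star U * B : Matrix.unitaryGroup (Fin d) ℂ) : Op d)) i i).re := by
    rw [hB, meanEnergy_conj_diagonal]
    refine Finset.sum_congr rfl fun i _ => ?_
    conv_lhs => rw [hr, map_sum]
    simp only [map_smul, Finset.mul_sum, Finset.sum_mul, Matrix.sum_apply, Complex.re_sum,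
      mul_smul_comm, smul_mul_assoc, Matrix.smul_apply, smul_eq_mul, Complex.re_ofReal_mul,
      Submonoid.coe_mul, Unitary.coe_star, star_mul, star_star, mul_assoc]
  have hD : ∀ i j, ((star ((star U * B : Matrix.unitaryGroup (Fin d) ℂ) : Op d) *
        Φ ((F : Op d) * Matrix.single j j 1 * star (F : Op d)) *
        ((star U * B : Matrix.unitaryGroup (Fin d) ℂ) : Op d)) i i).re =
      ∑ σ, w σ * σ.permMatrix ℝ i j := fun i j => by
    have := congrFun (congrFun hw i) j
    simp only [Matrix.sum_apply, Matrix.smul_apply, smul_eq_mul, Matrix.of_apply] at this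
    exact this.symm
  have hS : meanEnergy H ((U : Op d) * Φ ρ * star (U : Op d)) =
      ∑ σ, w σ * ∑ i, E i * r (σ i) := by
    rw [hE]
    simp only [hD, Finset.mul_sum]
    rw [Finset.sum_comm_cycle]
    refine Finset.sum_congr rfl fun σ _ => Finset.sum_congr rfl fun i _ => ?_
    simp [Equiv.Perm.permMatrix, PEquiv.toMatrix_apply]
    ring
  rw [hS, ← one_mul (⨅ _, _), ← hw1, Finset.sum_mul]
  refine Finset.sum_le_sum fun σ _ => mul_le_mul_of_nonneg_left ?_ (hw0 σ)
  rw [hB, hF]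
  exact iInf_meanEnergy_le_sum_perm B F E r σ

/-- The mean energy does not rise, by hypothesis, and the subtracted minimum does not fall, by
unitality. -/
theorem ergotropy_map_le {d : ℕ} {H : Op d} (hH : H.IsHermitian) {Φ : QuantumChannel d}
    (hΦ : IsUnitalEnergyNonincreasing H Φ) {ρ : Op d} (hρ : IsState ρ) :
    ergotropy H (Φ ρ) ≤ ergotropy H ρ :=
  sub_le_sub (hΦ.meanEnergy_le ρ hρ) (Φ.iInf_meanEnergy_le_map hΦ.map_one hH hρ.posSemidef.1)

theorem IsUAENICPR.isErgotropyNonincreasing {d : ℕ} {H : Op d} (hH : H.IsHermitian)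
    {C : QuantumChannel d} (hC : IsUAENICPR H C) : IsErgotropyNonincreasing H C := by
  obtain ⟨Φ, hΦ, p, τ, hp0, hp1, hτ, h⟩ := hC
  intro ρ hρ
  rw [h ρ hρ]
  refine (ergotropy_mix_le H _ _ hp0 hp1).trans ?_
  rw [hτ.ergotropy_eq_zero, mul_zero, add_zero]
  exact (mul_le_of_le_one_left (ergotropy_nonneg H _) hp1).trans (ergotropy_map_le hH hΦ hρ)

/-! ### Energy-preserving channels -/

/-- The unitary matrix whose columns are the vectors of an orthonormal basis. -/
theorem exists_unitary_of_orthonormalBasis {d : ℕ}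
    (b : OrthonormalBasis (Fin d) ℂ (EuclideanSpace ℂ (Fin d))) :
    ∃ B : Matrix.unitaryGroup (Fin d) ℂ, ∀ i j, (B : Op d) i j = b j i := by
  refine ⟨⟨Matrix.of fun i j => b j i, ?_⟩, fun _ _ => rfl⟩
  rw [Matrix.mem_unitaryGroup_iff']
  ext i j
  have h := orthonormal_iff_ite.1 b.orthonormal i j
  rw [PiLp.inner_apply] at h
  simp only [RCLike.inner_apply] at h
  simp only [Matrix.star_eq_conjTranspose, Matrix.mul_apply, Matrix.conjTranspose_apply,
    Matrix.of_apply, Matrix.one_apply, ← h]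
  exact Finset.sum_congr rfl fun k _ => mul_comm _ _

theorem inner_toEuclideanLin_eq {d : ℕ} {b : OrthonormalBasis (Fin d) ℂ (EuclideanSpace ℂ (Fin d))}
    {B : Op d} (hB : ∀ i j, B i j = b j i) (X : Op d) (i : Fin d) :
    inner ℂ (b i) (Matrix.toEuclideanLin X (b i)) = (star B * X * B) i i := by
  rw [mul_assoc, PiLp.inner_apply, Matrix.mul_apply]
  refine Finset.sum_congr rfl fun k _ => ?_
  rw [RCLike.inner_apply, mul_comm, Matrix.star_eq_conjTranspose, Matrix.conjTranspose_apply, hB,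
    Matrix.mul_apply]
  simp [Matrix.toLpLin_apply, Matrix.mulVec, dotProduct, hB]

/-- The quadratic form of `A` vanishes at the basis vector `k`, so positivity puts that vector in
the kernel. -/
theorem Matrix.PosSemidef.apply_eq_zero_of_diag_eq_zero {n : Type*} [Fintype n] [DecidableEq n]
    {A : Matrix n n ℂ} (hA : A.PosSemidef) {k : n} (hk : A k k = 0) (l : n) : A l k = 0 := by
  have h := (hA.dotProduct_mulVec_zero_iff (Pi.single k 1)).1 (by simp [hk])
  simpa using congrFun h l

/-- An energy-preserving channel fixes the energy eigenstates. -/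
theorem IsEnergyPreserving.map_eigenstate {d : ℕ}
    {b : OrthonormalBasis (Fin d) ℂ (EuclideanSpace ℂ (Fin d))} {Φ : QuantumChannel d}
    (hΦ : IsEnergyPreserving b Φ) {B : Matrix.unitaryGroup (Fin d) ℂ}
    (hB : ∀ i j, (B : Op d) i j = b j i) (j : Fin d) :
    Φ ((B : Op d) * Matrix.single j j 1 * star (B : Op d)) =
      (B : Op d) * Matrix.single j j 1 * star (B : Op d) := by
  have hBB := Unitary.coe_star_mul_self B
  have hBB' := Unitary.mul_star_self_of_mem B.2
  set P : Op d := (B : Op d) * Matrix.single j j 1 * star (B : Op d) with hP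
  have hcP : star (B : Op d) * P * (B : Op d) = Matrix.single j j 1 := by
    calc _ = (star (B : Op d) * (B : Op d)) * Matrix.single j j 1 *
            (star (B : Op d) * (B : Op d)) := by
          simp only [hP, mul_assoc]
      _ = _ := by rw [hBB, one_mul, mul_one]
  have hs : (Matrix.single j j (1 : ℂ)).PosSemidef := by
    rw [← Matrix.diagonal_single]
    exact Matrix.PosSemidef.diagonal (Pi.single_nonneg.2 zero_le_one)
  have hst : IsState P := by
    refine ⟨hs.mul_mul_conjTranspose_same (B : Op d), ?_⟩
    rw [hP, Matrix.trace_mul_comm, ← mul_assoc, hBB, one_mul, Matrix.trace_single_eq_same]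
  have hdiag : ∀ i, (star (B : Op d) * Φ P * (B : Op d)) i i = Matrix.single j j (1 : ℂ) i i := by
    intro i
    rw [← inner_toEuclideanLin_eq hB, hΦ P hst i, inner_toEuclideanLin_eq hB, hcP]
  have hpos : (star (B : Op d) * Φ P * (B : Op d)).PosSemidef :=
    (Φ.posSemidef_map hst.posSemidef).conjTranspose_mul_mul_same (B : Op d)
  -- In the energy basis the output has the diagonal of `single j j 1`, so every other column
  -- vanishes; hermiticity then clears the rows.
  have hcol : ∀ k l, k ≠ j → (star (B : Op d) * Φ P * (B : Op d)) l k = 0 := fun k l hk =>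
    hpos.apply_eq_zero_of_diag_eq_zero (by rw [hdiag, Matrix.single_apply_of_ne]; tauto) l
  have heq : star (B : Op d) * Φ P * (B : Op d) = Matrix.single j j 1 := by
    ext k l
    by_cases hl : l = j
    · by_cases hk : k = j
      · subst hl hk; exact hdiag _
      · rw [← hpos.1.apply, hcol k l hk, star_zero, Matrix.single_apply_of_ne]; tauto
    · rw [hcol l k hl, Matrix.single_apply_of_ne]; tauto
  calc Φ P = ((B : Op d) * star (B : Op d)) * Φ P * ((B : Op d) * star (B : Op d)) := by
        rw [hBB', one_mul, mul_one]
    _ = (B : Op d) * (star (B : Op d) * Φ P * (B : Op d)) * star (B : Op d) := by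
        simp only [mul_assoc]
    _ = P := by rw [heq]

/-- Energy-preserving channels are unital and do not change the mean energy. -/
theorem IsEnergyPreserving.isUnitalEnergyNonincreasing {d : ℕ} {H : Op d} {E : Fin d → ℝ}
    {b : OrthonormalBasis (Fin d) ℂ (EuclideanSpace ℂ (Fin d))}
    (hb : IsNondegenerateEigenbasis H E b) {Φ : QuantumChannel d} (hΦ : IsEnergyPreserving b Φ) :
    IsUnitalEnergyNonincreasing H Φ := by
  obtain ⟨B, hB⟩ := exists_unitary_of_orthonormalBasis b
  have hBB' := Unitary.mul_star_self_of_mem B.2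
  have hH : H = (B : Op d) * Matrix.diagonal (fun i => (E i : ℂ)) * star (B : Op d) := by
    have h : H * (B : Op d) = (B : Op d) * Matrix.diagonal (fun i => (E i : ℂ)) := by
      ext k i
      have := congrArg (fun v : EuclideanSpace ℂ (Fin d) => v k) (hb.apply_eq i)
      simp only [Matrix.toLpLin_apply, Matrix.mulVec, dotProduct, PiLp.smul_apply,
        smul_eq_mul] at this
      rw [Matrix.mul_diagonal, Matrix.mul_apply]
      simpa only [hB, mul_comm] using this
    rw [← h, mul_assoc, hBB', mul_one]
  refine ⟨?_, fun ρ hρ => le_of_eq ?_⟩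
  · have hsum : ∑ j, (B : Op d) * Matrix.single j j 1 * star (B : Op d) = 1 := by
      rw [← Finset.sum_mul, ← Finset.mul_sum, Matrix.sum_single_one, mul_one, hBB']
    rw [← hsum, map_sum]
    exact Finset.sum_congr rfl fun j _ => hΦ.map_eigenstate hB j
  · rw [hH, meanEnergy_conj_diagonal, meanEnergy_conj_diagonal]
    refine Finset.sum_congr rfl fun i _ => ?_
    rw [← inner_toEuclideanLin_eq hB, hΦ ρ hρ i, inner_toEuclideanLin_eq hB]

theorem mainTheorem1 {d : ℕ} (H : Op d) (hH : H.IsHermitian) (E : Fin d → ℝ)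
    (b : OrthonormalBasis (Fin d) ℂ (EuclideanSpace ℂ (Fin d)))
    (hb : IsNondegenerateEigenbasis H E b) :
    (∀ C : QuantumChannel d, IsEPCPR H b C → IsErgotropyNonincreasing H C) ∧
    (∀ C : QuantumChannel d, IsUAENICPR H C → IsErgotropyNonincreasing H C) := by
  refine ⟨fun C ⟨Φ, hΦ, hC⟩ => ?_, fun C hC => hC.isErgotropyNonincreasing hH⟩
  exact IsUAENICPR.isErgotropyNonincreasing hH ⟨Φ, hΦ.isUnitalEnergyNonincreasing hb, hC⟩
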